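/- Let $(R,\mathfrak m,k)$ be a commutative Noetherian local ring. For $R$-modules $M,N$ with projective resolutions $P_M,P_N$, let $(P_M,P_N)$ be the complex of graded homomorphisms, which in cohomological degree $n\in\mathbb Z$ is $\prod_{i}\operatorname{Hom}_R((P_M)_i,(P_N)_{i-n})$, with differential $\partial(f)=\partial f-(-1)^{n}f\partial$ for $f$ of degree $n$; its cohomology is $\operatorname{Ext}_R^*(M,N)$. Let $(P_M,P_N)_b$ be the subcomplex of homogeneous maps with only finitely many non-zero components. The Vogel cohomology $\widetilde{\operatorname{Ext}}{}_R^n(M,N)$ is the $n$-th cohomology of $(P_M,P_N)/(P_M,P_N)_b$, and $\zeta^n(M,N)\colon\operatorname{Ext}_R^n(M,N)\to\widetilde{\operatorname{Ext}}{}_R^n(M,N)$ is the map induced by the projection onto the quotient complex. For a finitely generated $R$-module $M\neq 0$, the $\zeta$-dimension of $M$ is the infimum in $\mathbb N\cup\{\infty\}$ (where $\mathbb N=\{0,1,2,\dots\}$) of all $n\in\mathbb N$ such that $\zeta^n(M,k)$ is an epimorphism and $\zeta^i(M,k)$ is an isomorphism for all $i>n$; the $\zeta$-dimension of $0$ is $-\infty$.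 Let $\mathcal Z$ be the full subcategory of the category of $R$-modules whose objects are the zero module and the finitely generated $R$-modules of $\zeta$-dimension zero. Let $0\to E\to L\to M\to 0$ be an exact sequence of $R$-modules. 1. (Closure under extensions.) If $E,M\in\mathcal Z$, then $L\in\mathcal Z$. 2. (Closure under kernels of epimorphisms.) If $L,M\in\mathcal Z$, then $E\in\mathcal Z$. Moreover, every finitely generated projective $R$-module belongs to $\mathcal Z$. -/

import Mathlib

open CategoryTheory

universe u

noncomputable section

namespace Vogel

open CochainComplex.HomComplex

variable (R : Type u) [CommRing R]

section Complexes

variable (F G : CochainComplex (ModuleCat.{u} R) ℤ)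

/-- The complex `(F, G)` of `R`-modules: in degree `n` it is `∏ p, Hom_R(F^p, G^(p+n))`, and the
differential is `∂ f = ∂ ∘ f - (-1)^n f ∘ ∂`. (The same as `CochainComplex.HomComplex F G`, with the
`R`-module structure kept.) -/
def homComplex : CochainComplex (ModuleCat.{u} R) ℤ where
  X n := ModuleCat.of R (Cochain F G n)
  d n m := ModuleCat.ofHom (δ_hom R F G n m)
  shape n m h := ModuleCat.hom_ext (LinearMap.ext fun z => δ_shape n m h z)
  d_comp_d' n m l _ _ := ModuleCat.hom_ext (LinearMap.ext fun z => δ_δ n m l z)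

/-- The submodule `(F, G)_b` of bounded homogeneous maps of degree `n`: those with only finitely
many non-zero components. -/
def boundedCochains (n : ℤ) : Submodule R (Cochain F G n) where
  carrier := {f | {p : ℤ | f.v p (p + n) rfl ≠ 0}.Finite}
  zero_mem' := by simp
  add_mem' {f g} hf hg := by
    refine (Set.Finite.union hf hg).subset fun p hp => ?_
    by_contra h
    simp only [Set.mem_union, Set.mem_ofPred_eq, not_or, not_not] at h
    exact hp (by simp [h.1, h.2])
  smul_mem' r f hf := by
    refine Set.Finite.subset hf fun p hp h => hp ?_
    simp [h]

/-- The differential maps bounded maps to bounded maps. -/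
lemma boundedCochains_le_comap (n m : ℤ) :
    boundedCochains R F G n ≤ (boundedCochains R F G m).comap (δ_hom R F G n m) := by
  intro f hf
  by_cases hnm : n + 1 = m
  · refine (Set.Finite.union hf (Set.Finite.image (fun p : ℤ => p - 1) hf)).subset fun p hp => ?_
    by_contra h
    simp only [Set.mem_union, Set.mem_ofPred_eq, not_or, not_not, Set.mem_image, not_exists,
      not_and] at h
    obtain ⟨h₁, h₂⟩ := h
    have h₃ : f.v (p + 1) (p + 1 + n) rfl = 0 := by
      by_contra h₃
      exact h₂ (p + 1) h₃ (by simp)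
    refine hp ?_
    change (δ n m f).v p (p + m) rfl = 0
    rw [δ_v n m hnm f p (p + m) rfl (p + n) (p + 1) (by lia) rfl]
    have h₄ : ∀ q (hq : p + 1 + n = q), f.v (p + 1) q hq = 0 := by
      rintro q rfl
      exact h₃
    simp [h₁, h₄]
  · change δ n m f ∈ boundedCochains R F G m
    rw [δ_shape n m hnm f]
    exact Submodule.zero_mem _

/-- The quotient complex `(F, G) / (F, G)_b`. -/
def vogelComplex : CochainComplex (ModuleCat.{u} R) ℤ where
  X n := ModuleCat.of R (Cochain F G n ⧸ boundedCochains R F G n)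
  d n m := ModuleCat.ofHom
    ((boundedCochains R F G n).mapQ (boundedCochains R F G m) (δ_hom R F G n m)
      (boundedCochains_le_comap R F G n m))
  shape n m h := by
    refine ModuleCat.hom_ext (LinearMap.ext fun z => ?_)
    obtain ⟨z, rfl⟩ := Submodule.mkQ_surjective _ z
    exact congrArg (boundedCochains R F G m).mkQ (δ_shape n m h z)
  d_comp_d' n m l _ _ := by
    refine ModuleCat.hom_ext (LinearMap.ext fun z => ?_)
    obtain ⟨z, rfl⟩ := Submodule.mkQ_surjective _ z
    exact congrArg (boundedCochains R F G l).mkQ (δ_δ n m l z)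

/-- The canonical projection `(F, G) ⟶ (F, G) / (F, G)_b`. -/
def toVogelComplex : homComplex R F G ⟶ vogelComplex R F G where
  f n := ModuleCat.ofHom (boundedCochains R F G n).mkQ
  comm' _ _ _ := rfl

end Complexes

variable {R}

/-- A projective resolution `P_M` of `M`, as a complex indexed by `ℤ` with cohomological grading
(so `P_i` sits in degree `-i`). -/
def resolution (M : ModuleCat.{u} R) : CochainComplex (ModuleCat.{u} R) ℤ :=
  (projectiveResolution M).cochainComplex

/-- `Ext_R^n(M, N)`, as the cohomology of `(P_M, P_N)`. -/
def ext (M N : ModuleCat.{u} R) (n : ℤ) : ModuleCat.{u} R :=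
  (homComplex R (resolution M) (resolution N)).homology n

/-- Vogel cohomology of the pair `(M, N)` in degree `n`: the cohomology of
`(P_M, P_N) / (P_M, P_N)_b`. -/
def vogelExt (M N : ModuleCat.{u} R) (n : ℤ) : ModuleCat.{u} R :=
  (vogelComplex R (resolution M) (resolution N)).homology n

/-- The comparison map `ζ^n(M, N)` from `Ext_R^n(M, N)` to Vogel cohomology. -/
def zeta (M N : ModuleCat.{u} R) (n : ℤ) : ext M N n ⟶ vogelExt M N n :=
  HomologicalComplex.homologyMap (toVogelComplex R (resolution M) (resolution N)) n

variable (R) in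
/-- The residue field `k` of `R`, as an `R`-module. -/
def residueModule [IsLocalRing R] : ModuleCat.{u} R :=
  ModuleCat.of R (IsLocalRing.ResidueField R)

open Classical in
/-- The `ζ`-dimension of `M`: `-∞` if `M = 0`, and otherwise the infimum in `ℕ ∪ {∞}` of the `n`
such that `ζ^n(M, k)` is an epimorphism and `ζ^i(M, k)` is an isomorphism for all `i > n`. -/
def zetaDim [IsLocalRing R] (M : ModuleCat.{u} R) : WithBot ℕ∞ :=
  if Subsingleton M then ⊥
  else ((⨅ (n : ℕ) (_ : Epi (zeta M (residueModule R) n) ∧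
    ∀ i : ℤ, (n : ℤ) < i → IsIso (zeta M (residueModule R) i)), (n : ℕ∞) : ℕ∞) : WithBot ℕ∞)

variable (R) in
/-- The full subcategory `𝒵`: the finitely generated modules of `ζ`-dimension zero, together with
the zero module. -/
def zetaZero [IsLocalRing R] : ObjectProperty (ModuleCat.{u} R) := fun M =>
  Module.Finite R M ∧ (Subsingleton M ∨ zetaDim M = 0)

end Vogel

end

/-! Write $B(M)$ for the complex $(P_M,P_k)_b$. The long exact sequence of $0\to
B(M)\to(P_M,P_k)\to(P_M,P_k)/B(M)\to 0$ turns the condition on $\zeta$ into $H^n(B(M))=0$ for all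
$n>0$ (`zetaZero_iff`). This vanishing depends only on the homotopy type of $P_M$, because composing
a bounded cochain with any cochain leaves it bounded. For $0\to E\to L\to M\to 0$, the complex $P_M$
is homotopy equivalent to the cone of a lift $P_E\to P_L$, so the long exact sequence of a cone
passes the vanishing from $E,M$ to $L$ and from $L,M$ to $E$. If $M$ is projective, $P_M$ may be
replaced by $M$ in degree zero, which has no nonzero maps of positive degree to $P_k$. -/

namespace Vogel

open CochainComplex CochainComplex.HomComplex

/-! ### Bounded cochains, homotopies and mapping cones -/

section BoundedCochains

variable {R : Type u} [CommRing R] {F F' G K : CochainComplex (ModuleCat.{u} R) ℤ}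

lemma comp_mem_boundedCochains {n₁ n₂ n₁₂ : ℤ} (f : Cochain F G n₁) {g : Cochain G K n₂}
    (hg : g ∈ boundedCochains R G K n₂) (h : n₁ + n₂ = n₁₂) :
    f.comp g h ∈ boundedCochains R F K n₁₂ := by
  refine (Set.Finite.image (fun p : ℤ => p - n₁) hg).subset fun p hp => ?_
  refine ⟨p + n₁, fun h₀ => hp ?_, by simp⟩
  have h₁ : ∀ q (hq : p + n₁ + n₂ = q), g.v (p + n₁) q hq = 0 := by
    rintro q rfl
    exact h₀
  rw [Cochain.comp_v f g h p (p + n₁) _ rfl (by lia), h₁, Limits.comp_zero]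

lemma units_smul_mem_boundedCochains {n : ℤ} (ε : ℤˣ) {f : Cochain F G n}
    (hf : f ∈ boundedCochains R F G n) : ε • f ∈ boundedCochains R F G n := by
  obtain rfl | rfl := Int.units_eq_one_or ε
  · simpa using hf
  · simpa using hf

variable (R F G) in
/-- Every bounded cocycle of positive degree from `F` to `G` is the coboundary of a bounded
cochain, i.e. the cohomology of `(F, G)_b` vanishes in positive degrees. -/
def BoundedVanishing : Prop :=
  ∀ (m n : ℤ), m + 1 = n → 0 < n → ∀ f ∈ boundedCochains R F G n, δ n (n + 1) f = 0 →
    ∃ g ∈ boundedCochains R F G m, δ m n g = f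

/-- `BoundedVanishing` passes to homotopy retracts in the first variable. -/
lemma BoundedVanishing.of_homotopy (hF : BoundedVanishing R F G) (s : F' ⟶ F) (π : F ⟶ F')
    (ho : Homotopy (𝟙 F') (s ≫ π)) : BoundedVanishing R F' G := by
  intro m n hmn hn f hf hδ
  obtain ⟨g, hg, hgf⟩ := hF m n hmn hn ((Cochain.ofHom π).comp f (zero_add n))
    (comp_mem_boundedCochains _ hf _) (by simp [hδ])
  -- The first term bounds `f` pulled back along `s ≫ π`. The homotopy term bounds the difference
  -- between `f` and this pullback.
  refine ⟨(Cochain.ofHom s).comp g (zero_add m) +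
      n.negOnePow • (Cochain.ofHomotopy ho).comp f (by lia),
    Submodule.add_mem _ (comp_mem_boundedCochains _ hg _)
      (units_smul_mem_boundedCochains _ (comp_mem_boundedCochains _ hf _)), ?_⟩
  rw [δ_add, δ_ofHom_comp, hgf, δ_units_smul,
    δ_comp (Cochain.ofHomotopy ho) f _ 0 (n + 1) n hmn (by lia) rfl, hδ]
  simp [smul_smul, Cochain.sub_comp, Cochain.ofHom_comp]

lemma BoundedVanishing.of_homotopyEquiv (hF : BoundedVanishing R F G) (e : HomotopyEquiv F F') :
    BoundedVanishing R F' G :=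
  hF.of_homotopy e.inv e.hom e.homotopyInvHomId.symm

/-- A complex in nonnegative degrees has no nonzero maps of positive degree to a complex in
nonpositive degrees. -/
lemma boundedVanishing_of_isStrictlyGE_of_isStrictlyLE [F.IsStrictlyGE 0] [G.IsStrictlyLE 0] :
    BoundedVanishing R F G := by
  intro m n hmn hn f _ _
  refine ⟨0, Submodule.zero_mem _, ?_⟩
  rw [δ_zero]
  ext p q hpq : 1
  obtain hp | hp := lt_or_ge p 0
  · exact (F.isZero_of_isStrictlyGE 0 p hp).eq_of_src _ _
  · exact (G.isZero_of_isStrictlyLE 0 q (by lia)).eq_of_tgt _ _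

variable {E L : CochainComplex (ModuleCat.{u} R) ℤ} (ψ : E ⟶ L)

/-- Exactness of $H^n(\mathrm{cone})\to H^n(L)\to H^n(E)$: a cocycle on `L` whose pullback to `E` is
a coboundary extends to the cone. -/
lemma BoundedVanishing.of_mappingCone (hE : BoundedVanishing R E G)
    (hM : BoundedVanishing R (mappingCone ψ) G) : BoundedVanishing R L G := by
  intro m n hmn hn f hf hδ
  -- The sign is the one that makes the cochain on the cone with components `g` and `f` a cocycle.
  obtain ⟨g, hg, hgf⟩ := hE m n hmn hn (n.negOnePow • (Cochain.ofHom ψ).comp f (zero_add n))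
    (units_smul_mem_boundedCochains _ (comp_mem_boundedCochains _ hf _)) (by simp [hδ])
  obtain ⟨h, hh, hhf⟩ := hM m n hmn hn (mappingCone.descCochain ψ g f hmn)
    (Submodule.add_mem _ (comp_mem_boundedCochains _ hg _) (comp_mem_boundedCochains _ hf _))
    (by simp [mappingCone.δ_descCochain _ _ _ _ _ rfl, hgf, hδ, Int.negOnePow_succ])
  exact ⟨(Cochain.ofHom (mappingCone.inr ψ)).comp h (zero_add m),
    comp_mem_boundedCochains _ hh _, by simp [hhf]⟩

/-- Exactness of $H^n(L)\to H^n(E)\to H^{n+1}(\mathrm{cone})$; the cone is used one degree higher.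
-/
lemma BoundedVanishing.source_of_mappingCone (hL : BoundedVanishing R L G)
    (hM : BoundedVanishing R (mappingCone ψ) G) : BoundedVanishing R E G := by
  intro m n hmn hn f hf hδ
  obtain ⟨h, hh, hhf⟩ := hM n (n + 1) rfl (by lia)
    ((mappingCone.fst ψ).1.comp f (add_comm 1 n)) (comp_mem_boundedCochains _ hf _)
    (by simp [δ_comp (mappingCone.fst ψ).1 f (add_comm 1 n) 2 (n + 1) (n + 1 + 1) rfl rfl rfl, hδ])
  obtain ⟨g, hg, hgf⟩ := hL m n hmn hn ((Cochain.ofHom (mappingCone.inr ψ)).comp h (zero_add n))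
    (comp_mem_boundedCochains _ hh _) (by simp [hhf])
  refine ⟨(mappingCone.inl ψ).comp h (by lia) -
      n.negOnePow • (Cochain.ofHom ψ).comp g (zero_add m),
    Submodule.sub_mem _ (comp_mem_boundedCochains _ hh _)
      (units_smul_mem_boundedCochains _ (comp_mem_boundedCochains _ hg _)), ?_⟩
  rw [δ_sub, δ_units_smul, δ_ofHom_comp, hgf,
    δ_comp (mappingCone.inl ψ) h _ 0 (n + 1) n hmn (by lia) rfl, hhf]
  simp [Cochain.ofHom_comp]

end BoundedCochains

end Vogel

universe v w

/-! ### K-projective complexes and the derived category -/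

namespace CochainComplex

open HomologicalComplex DerivedCategory Pretriangulated

variable {C : Type u} [Category.{v} C] [Abelian C]

/-- K-projective complexes that are isomorphic in the derived category are homotopy equivalent. -/
lemma IsKProjective.nonempty_homotopyEquiv [HasDerivedCategory.{w} C] {K L : CochainComplex C ℤ}
    [K.IsKProjective] [L.IsKProjective] (e : Q.obj K ≅ Q.obj L) :
    Nonempty (HomotopyEquiv K L) := by
  let e' : Qh.obj ((HomotopyCategory.quotient _ _).obj K) ≅
      Qh.obj ((HomotopyCategory.quotient _ _).obj L) :=
    (quotientCompQhIso C).app K ≪≫ e ≪≫ ((quotientCompQhIso C).app L).symm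
  -- Out of a K-projective complex, homotopy classes of maps agree with derived morphisms, so `e'`
  -- and its inverse lift.
  obtain ⟨f, hf⟩ := (Qh_map_bijective K _).surjective e'.hom
  obtain ⟨g, hg⟩ := (Qh_map_bijective L _).surjective e'.inv
  exact ⟨HomotopyCategory.homotopyEquivOfIso
    { hom := f
      inv := g
      hom_inv_id := (Qh_map_bijective K _).injective (by simp [hf, hg])
      inv_hom_id := (Qh_map_bijective L _).injective (by simp [hf, hg]) }⟩

/-- Any morphism in the derived category from a K-projective complex is represented by a morphism
of complexes. -/
lemma IsKProjective.Q_map_surjective [HasDerivedCategory.{w} C] {K L : CochainComplex C ℤ}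
    [K.IsKProjective] (g : Q.obj K ⟶ Q.obj L) : ∃ f : K ⟶ L, Q.map f = g := by
  obtain ⟨f, hf⟩ := (Qh_map_bijective K _).surjective
    ((quotientCompQhIso C).hom.app K ≫ g ≫ (quotientCompQhIso C).inv.app L)
  obtain ⟨f, rfl⟩ := (HomotopyCategory.quotient _ _).map_surjective f
  refine ⟨f, ?_⟩
  have := (quotientCompQhIso C).hom.naturality f
  rw [← cancel_epi ((quotientCompQhIso C).hom.app K), ← this, Functor.comp_map, hf]
  simp

instance isStrictlyLE_mappingCone {K L : CochainComplex C ℤ} (f : K ⟶ L) (n : ℤ)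
    [K.IsStrictlyLE n] [L.IsStrictlyLE n] : (mappingCone f).IsStrictlyLE n := by
  rw [isStrictlyLE_iff]
  intro i hi
  rw [mappingCone.isZero_X_iff]
  exact ⟨K.isZero_of_isStrictlyLE n _ (by lia), L.isZero_of_isStrictlyLE n _ hi⟩

instance projective_mappingCone_X {K L : CochainComplex C ℤ} (f : K ⟶ L)
    [∀ n, Projective (K.X n)] [∀ n, Projective (L.X n)] (n : ℤ) :
    Projective ((mappingCone f).X n) :=
  Projective.of_iso (homotopyCofiber.XIsoBiprod f n (n + 1) rfl).symm inferInstance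

end CochainComplex

/-! ### Resolutions of cokernels and of projective objects -/

namespace CategoryTheory.ProjectiveResolution

open _root_.DerivedCategory Pretriangulated CochainComplex

variable {C : Type u} [Category.{v} C] [Abelian C]

/-- The augmentation of a projective resolution, as an isomorphism in the derived category. -/
noncomputable def isoQ [HasDerivedCategory.{w} C] {X : C} (P : ProjectiveResolution X) :
    Q.obj P.cochainComplex ≅ (DerivedCategory.singleFunctor C 0).obj X :=
  have : IsIso (Q.map P.π') := (isIso_Q_map_iff_quasiIso _ _).2 inferInstance
  asIso (Q.map P.π') ≪≫ ((singleFunctorIsoCompQ C 0).app X).symm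

/-- A projective resolution of the cokernel of a monomorphism is homotopy equivalent to the
mapping cone of a lift of the monomorphism to projective resolutions. -/
lemma exists_homotopyEquiv_mappingCone {S : ShortComplex C} (hS : S.ShortExact)
    (P₁ : ProjectiveResolution S.X₁) (P₂ : ProjectiveResolution S.X₂)
    (P₃ : ProjectiveResolution S.X₃) :
    ∃ ψ : P₁.cochainComplex ⟶ P₂.cochainComplex,
      Nonempty (HomotopyEquiv (mappingCone ψ) P₃.cochainComplex) := by
  let := HasDerivedCategory.standard C
  obtain ⟨ψ, hψ⟩ := IsKProjective.Q_map_surjective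
    (P₁.isoQ.hom ≫ (DerivedCategory.singleFunctor C 0).map S.f ≫ P₂.isoQ.inv)
  -- The cone has projective terms and vanishes in positive degrees.
  have : (mappingCone ψ).IsKProjective := isKProjective_of_projective _ 0
  let e := isoTriangleOfIso₁₂ _ _ (mappingCone_triangle_distinguished ψ)
    hS.singleTriangle_distinguished P₁.isoQ P₂.isoQ (by
      change Q.map ψ ≫ _ = _ ≫ (DerivedCategory.singleFunctor C 0).map S.f
      simp [hψ])
  exact ⟨ψ, IsKProjective.nonempty_homotopyEquiv (Triangle.π₃.mapIso e ≪≫ P₃.isoQ.symm)⟩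

/-- A projective resolution of a projective object is homotopy equivalent to that object, placed in
degree zero. -/
lemma nonempty_homotopyEquiv_single {X : C} [Projective X] (P : ProjectiveResolution X) :
    Nonempty (HomotopyEquiv ((CochainComplex.singleFunctor C 0).obj X) P.cochainComplex) := by
  let := HasDerivedCategory.standard C
  have (n : ℤ) : Projective (((CochainComplex.singleFunctor C 0).obj X).X n) := by
    by_cases hn : n = 0
    · subst hn
      exact Projective.of_iso (HomologicalComplex.singleObjXSelf (.up ℤ) 0 X).symm inferInstance
    · exact (HomologicalComplex.isZero_single_obj_X _ _ _ _ hn).projective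
  have : ((CochainComplex.singleFunctor C 0).obj X).IsKProjective := isKProjective_of_projective _ 0
  exact IsKProjective.nonempty_homotopyEquiv P.isoQ.symm

end CategoryTheory.ProjectiveResolution

namespace Vogel

open CochainComplex CochainComplex.HomComplex

/-! ### Bounded cohomology and the comparison map -/

section Comparison

variable (R : Type u) [CommRing R] (F G : CochainComplex (ModuleCat.{u} R) ℤ)

/-- The complex `(F, G)_b` of bounded cochains. -/
def boundedComplex : CochainComplex (ModuleCat.{u} R) ℤ where
  X n := ModuleCat.of R (boundedCochains R F G n)
  d n m := ModuleCat.ofHom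
    ((δ_hom R F G n m).restrict (boundedCochains_le_comap R F G n m))
  shape n m h := ModuleCat.hom_ext (LinearMap.ext fun z => Subtype.ext (δ_shape n m h z.1))
  d_comp_d' n m l _ _ := ModuleCat.hom_ext (LinearMap.ext fun z => Subtype.ext (δ_δ n m l z.1))

/-- The inclusion of `(F, G)_b` in `(F, G)`. -/
def boundedComplexι : boundedComplex R F G ⟶ homComplex R F G where
  f n := ModuleCat.ofHom (boundedCochains R F G n).subtype
  comm' _ _ _ := rfl

lemma boundedComplexι_comp_toVogelComplex :
    boundedComplexι R F G ≫ toVogelComplex R F G = 0 := by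
  ext n x
  exact (Submodule.Quotient.mk_eq_zero _).2 x.2

/-- The short complex `(F, G)_b ⟶ (F, G) ⟶ (F, G) / (F, G)_b`. -/
def vogelShortComplex : ShortComplex (CochainComplex (ModuleCat.{u} R) ℤ) where
  f := boundedComplexι R F G
  g := toVogelComplex R F G
  zero := boundedComplexι_comp_toVogelComplex R F G

lemma vogelShortComplex_shortExact : (vogelShortComplex R F G).ShortExact := by
  refine HomologicalComplex.shortExact_of_degreewise_shortExact _ fun n => ?_
  refine ModuleCat.shortComplex_shortExact _ ?_ Subtype.val_injective (Submodule.mkQ_surjective _)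
  exact LinearMap.exact_subtype_mkQ (boundedCochains R F G n)

lemma isZero_homology_boundedComplex_iff (m n : ℤ) (hmn : m + 1 = n) :
    Limits.IsZero ((boundedComplex R F G).homology n) ↔
      ∀ f ∈ boundedCochains R F G n, δ n (n + 1) f = 0 →
        ∃ g ∈ boundedCochains R F G m, δ m n g = f := by
  rw [← HomologicalComplex.exactAt_iff_isZero_homology,
    HomologicalComplex.exactAt_iff' _ m n (n + 1) (by simp; lia) (by simp),
    ShortComplex.moduleCat_exact_iff]
  constructor
  · intro h f hf hδ
    obtain ⟨g, hg⟩ := h ⟨f, hf⟩ (Subtype.ext hδ)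
    exact ⟨g.1, g.2, congrArg Subtype.val hg⟩
  · rintro h ⟨f, hf⟩ hδ
    obtain ⟨g, hg, hgf⟩ := h f hf (congrArg Subtype.val hδ)
    exact ⟨⟨g, hg⟩, Subtype.ext hgf⟩

lemma boundedVanishing_iff_isZero_homology :
    BoundedVanishing R F G ↔
      ∀ n : ℤ, 0 < n → Limits.IsZero ((boundedComplex R F G).homology n) := by
  constructor
  · intro h n hn
    exact (isZero_homology_boundedComplex_iff R F G (n - 1) n (by lia)).2 (h _ _ (by lia) hn)
  · intro h m n hmn hn
    exact (isZero_homology_boundedComplex_iff R F G m n hmn).1 (h n hn)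

/-- The cohomology of `(F, G)_b` vanishes in positive degrees if and only if the comparison map is
an epimorphism in degree zero and an isomorphism in positive degrees. -/
lemma boundedVanishing_iff :
    BoundedVanishing R F G ↔
      Epi (HomologicalComplex.homologyMap (toVogelComplex R F G) 0) ∧
      ∀ i : ℤ, 0 < i → IsIso (HomologicalComplex.homologyMap (toVogelComplex R F G) i) := by
  rw [boundedVanishing_iff_isZero_homology]
  have hS := vogelShortComplex_shortExact R F G
  constructor
  · intro h
    have epi (i : ℤ) (hi : 0 ≤ i) :
        Epi (HomologicalComplex.homologyMap (toVogelComplex R F G) i) :=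
      (hS.homology_exact₃ i (i + 1) rfl).epi_f ((h (i + 1) (by lia)).eq_of_tgt _ _)
    refine ⟨epi 0 le_rfl, fun i hi => ?_⟩
    have := epi i hi.le
    have : Mono (HomologicalComplex.homologyMap (toVogelComplex R F G) i) :=
      (hS.homology_exact₂ i).mono_g ((h i hi).eq_of_src _ _)
    exact isIso_of_mono_of_epi _
  · rintro ⟨h₀, h⟩ n hn
    have epi (i : ℤ) (hi : 0 ≤ i) :
        Epi (HomologicalComplex.homologyMap (toVogelComplex R F G) i) := by
      obtain rfl | hi := hi.eq_or_lt
      · exact h₀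
      · have := h i hi
        infer_instance
    have := h n hn
    have := epi (n - 1) (by lia)
    have hrel : (ComplexShape.up ℤ).Rel (n - 1) n := by simp
    -- Surjectivity in degree `n - 1` kills the connecting map, so the inclusion is injective on
    -- $H^n$; injectivity in degree `n` makes it zero there.
    have hmono : Mono (HomologicalComplex.homologyMap (boundedComplexι R F G) n) :=
      (hS.homology_exact₁ (n - 1) n hrel).mono_g
        ((cancel_epi (HomologicalComplex.homologyMap (toVogelComplex R F G) (n - 1))).1
          ((hS.comp_δ (n - 1) n hrel).trans Limits.comp_zero.symm))
    have hzero : HomologicalComplex.homologyMap (boundedComplexι R F G) n = 0 := by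
      rw [← cancel_mono (HomologicalComplex.homologyMap (toVogelComplex R F G) n),
        Limits.zero_comp]
      rw [← HomologicalComplex.homologyMap_comp, boundedComplexι_comp_toVogelComplex,
        HomologicalComplex.homologyMap_zero]
    rw [Limits.IsZero.iff_id_eq_zero, ← cancel_mono
      (HomologicalComplex.homologyMap (boundedComplexι R F G) n), hzero]
    simp

end Comparison

/-! ### The category $\mathcal Z$ and bounded cohomology -/

section ZetaZero

variable {R : Type u} [CommRing R]

lemma boundedVanishing_resolution_of_projective (P : ModuleCat.{u} R) [Projective P]
    (N : ModuleCat.{u} R) : BoundedVanishing R (resolution P) (resolution N) := by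
  obtain ⟨e⟩ := (projectiveResolution P).nonempty_homotopyEquiv_single
  have : (resolution N).IsStrictlyLE 0 :=
    inferInstanceAs ((projectiveResolution N).cochainComplex.IsStrictlyLE 0)
  exact boundedVanishing_of_isStrictlyGE_of_isStrictlyLE.of_homotopyEquiv e

lemma zetaDim_eq_zero_iff [IsLocalRing R] (M : ModuleCat.{u} R) [Nontrivial M] :
    zetaDim M = 0 ↔ BoundedVanishing R (resolution M) (resolution (residueModule R)) := by
  rw [boundedVanishing_iff, zetaDim, if_neg (not_subsingleton M), ← WithBot.coe_zero,
    WithBot.coe_inj]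
  constructor
  · intro h
    by_contra hc
    have : (1 : ℕ∞) ≤ ⨅ (n : ℕ) (_ : Epi (zeta M (residueModule R) n) ∧
        ∀ i : ℤ, (n : ℤ) < i → IsIso (zeta M (residueModule R) i)), (n : ℕ∞) := by
      refine le_iInf₂ fun n hn => ?_
      obtain rfl | hn' := Nat.eq_zero_or_pos n
      · exact (hc hn).elim
      · exact_mod_cast hn'
    rw [h] at this
    exact absurd this (by simp)
  · intro h
    exact le_antisymm (iInf₂_le (0 : ℕ) h) zero_le

lemma zetaZero_iff [IsLocalRing R] (M : ModuleCat.{u} R) :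
    zetaZero R M ↔ Module.Finite R M ∧
      BoundedVanishing R (resolution M) (resolution (residueModule R)) := by
  refine and_congr_right fun _ => ?_
  obtain hM | hM := subsingleton_or_nontrivial M
  · have : Projective M := (ModuleCat.isZero_of_subsingleton M).projective
    simp [hM, boundedVanishing_resolution_of_projective M]
  · simp [not_subsingleton M, zetaDim_eq_zero_iff M]

end ZetaZero

end Vogel

theorem proposition1p10 {R : Type u} [CommRing R] [IsNoetherianRing R] [IsLocalRing R] :
    (∀ S : ShortComplex (ModuleCat.{u} R), S.ShortExact →
      Vogel.zetaZero R S.X₁ → Vogel.zetaZero R S.X₃ → Vogel.zetaZero R S.X₂) ∧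
    (∀ S : ShortComplex (ModuleCat.{u} R), S.ShortExact →
      Vogel.zetaZero R S.X₂ → Vogel.zetaZero R S.X₃ → Vogel.zetaZero R S.X₁) ∧
    (∀ P : ModuleCat.{u} R, Module.Finite R P → Module.Projective R P →
      Vogel.zetaZero R P) := by
  simp only [Vogel.zetaZero_iff]
  refine ⟨fun S hS ⟨_, h₁⟩ ⟨_, h₃⟩ => ⟨?_, ?_⟩, fun S hS ⟨_, h₂⟩ ⟨_, h₃⟩ => ⟨?_, ?_⟩,
    fun P hP _ => ⟨hP, ?_⟩⟩
  · exact Module.Finite.of_exact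
      ((ShortComplex.ShortExact.moduleCat_exact_iff_function_exact S).1 hS.exact)
      hS.moduleCat_surjective_g
  · obtain ⟨ψ, ⟨e⟩⟩ := ProjectiveResolution.exists_homotopyEquiv_mappingCone hS
      (projectiveResolution S.X₁) (projectiveResolution S.X₂) (projectiveResolution S.X₃)
    exact h₁.of_mappingCone ψ (h₃.of_homotopyEquiv e.symm)
  -- Over a Noetherian ring, submodules of finitely generated modules are finitely generated.
  · exact Module.Finite.of_injective S.f.hom hS.moduleCat_injective_f
  · obtain ⟨ψ, ⟨e⟩⟩ := ProjectiveResolution.exists_homotopyEquiv_mappingCone hS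
      (projectiveResolution S.X₁) (projectiveResolution S.X₂) (projectiveResolution S.X₃)
    exact h₂.source_of_mappingCone ψ (h₃.of_homotopyEquiv e.symm)
  · exact Vogel.boundedVanishing_resolution_of_projective P _
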